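/- Let $F$ be a finitely generated free group with a finite free basis $X=\{x_1,\dots,x_n\}$, $n\ge 0$. A \emph{free splitting} $A*B$ of $F$ is a pair $(A,B)$ of subgroups that together generate $F$ and are such that whenever $a_1b_1\cdots a_kb_k=1$ with $k\ge1$, $a_i\in A$, $b_i\in B$, some $a_i$ or some $b_i$ is trivial. It is \emph{proper} if $A\ne F$ and $B\ne F$. An element $g\in F$ is \emph{elliptic} to $A*B$ if it lies in $xAx^{-1}\cup xBx^{-1}$ for some $x\in F$. Two proper free splittings $A*B$ and $C*D$ are equivalent if for some $x\in F$ either $A=xCx^{-1}$, $B=xDx^{-1}$ or $A=xDx^{-1}$, $B=xCx^{-1}$; the class of $A*B$ is written $[A*B]$. A nontrivial cyclic word is a nonempty cyclically ordered sequence of letters of $X\cup X^{-1}$ with no two consecutive letters inverse to each other; it is elliptic to $[A*B]$ if an element of $F$ that it spells, read linearly from some letter, is elliptic to $A*B$. The \emph{ellipticity graph} $\mathcal Z(F)$ is the bipartite graph whose vertices are the classes $[A*B]$ of proper free splittings and the nontrivial cyclic words, where $[A*B]$ and $w$ are adjacent exactly when $w$ is elliptic to $[A*B]$. A free splitting is given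 to an algorithm by two finite lists of words over $X\cup X^{-1}$, one generating $A$ and one generating $B$. Every free splitting of $F$ can be given in this way. Theorem. There is an algorithm (a computable function with values yes/no) that, given two free splittings $A*B$ and $C*D$ of $F$, decides whether there is a nontrivial element of $F$ that is elliptic to both of them. Moreover, if both splittings are proper, the algorithm answers yes if and only if the vertices $[A*B]$ and $[C*D]$ are at distance at most two in $\mathcal Z(F)$; hence, if $[A*B]\neq[C*D]$, it answers yes if and only if these vertices are at distance exactly two. -/

import Mathlib

namespace EllipticityGraph

section Splittings

variable {G : Type*} [Group G]

/-- The conjugate subgroup `x A x⁻¹`. -/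
def conjSubgroup (x : G) (A : Subgroup G) : Subgroup G :=
  A.map (MulAut.conj x).toMonoidHom

theorem conjSubgroup_one (A : Subgroup G) : conjSubgroup 1 A = A := by
  ext g
  simp [conjSubgroup]

theorem conjSubgroup_mul (x y : G) (A : Subgroup G) :
    conjSubgroup (x * y) A = conjSubgroup x (conjSubgroup y A) := by
  ext g
  simp [conjSubgroup, mul_assoc]

theorem eq_conjSubgroup_inv {x : G} {A C : Subgroup G} (h : A = conjSubgroup x C) :
    C = conjSubgroup x⁻¹ A := by
  rw [h, ← conjSubgroup_mul, inv_mul_cancel, conjSubgroup_one]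

/-- `(A, B)` is a free splitting of `G`: whenever a nonempty product `a₁b₁a₂b₂⋯aₙbₙ`
with `aᵢ ∈ A` and `bᵢ ∈ B` equals the identity, some `aᵢ` or some `bᵢ` is the identity;
and `A`, `B` together generate `G`. -/
structure IsFreeSplitting (A B : Subgroup G) : Prop where
  free : ∀ l : List (A × B), l ≠ [] → (l.map fun p => (p.1 : G) * (p.2 : G)).prod = 1 →
    ∃ p ∈ l, p.1 = 1 ∨ p.2 = 1
  generate : A ⊔ B = ⊤

/-- `g` is elliptic to the splitting `(A, B)`: it lies in a conjugate of `A` or of `B`. -/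
def IsElliptic (A B : Subgroup G) (g : G) : Prop :=
  ∃ x : G, g ∈ conjSubgroup x A ∨ g ∈ conjSubgroup x B

variable (G) in
/-- A free splitting both of whose factors are proper subgroups. -/
structure ProperFreeSplitting where
  left : Subgroup G
  right : Subgroup G
  isFreeSplitting : IsFreeSplitting left right
  left_ne_top : left ≠ ⊤
  right_ne_top : right ≠ ⊤

variable (G) in
/-- Equivalence of proper free splittings: simultaneous conjugacy of the two factors,
up to exchanging the factors. -/
instance splittingSetoid : Setoid (ProperFreeSplitting G) where
  r S T := ∃ x : G,
    (S.left = conjSubgroup x T.left ∧ S.right = conjSubgroup x T.right) ∨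
    (S.left = conjSubgroup x T.right ∧ S.right = conjSubgroup x T.left)
  iseqv := by
    refine ⟨fun S => ⟨1, Or.inl ⟨(conjSubgroup_one _).symm, (conjSubgroup_one _).symm⟩⟩, ?_, ?_⟩
    · rintro S T ⟨x, ⟨h1, h2⟩ | ⟨h1, h2⟩⟩
      · exact ⟨x⁻¹, Or.inl ⟨eq_conjSubgroup_inv h1, eq_conjSubgroup_inv h2⟩⟩
      · exact ⟨x⁻¹, Or.inr ⟨eq_conjSubgroup_inv h2, eq_conjSubgroup_inv h1⟩⟩
    · rintro S T U ⟨x, ⟨h1, h2⟩ | ⟨h1, h2⟩⟩ ⟨y, ⟨h3, h4⟩ | ⟨h3, h4⟩⟩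
      · exact ⟨x * y, Or.inl (by simp [conjSubgroup_mul, h1, h2, h3, h4])⟩
      · exact ⟨x * y, Or.inr (by simp [conjSubgroup_mul, h1, h2, h3, h4])⟩
      · exact ⟨x * y, Or.inr (by simp [conjSubgroup_mul, h1, h2, h3, h4])⟩
      · exact ⟨x * y, Or.inl (by simp [conjSubgroup_mul, h1, h2, h3, h4])⟩

variable (G) in
/-- Equivalence classes `[A * B]` of proper free splittings. -/
abbrev SplittingClass := Quotient (splittingSetoid G)

end Splittings

/-- Words in the letters `X ∪ X⁻¹`, where `X = {x₀, …, xₙ₋₁}`: the letter `(i, true)` is `xᵢ`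
and `(i, false)` is `xᵢ⁻¹`. Words need not be reduced. -/
abbrev Word (n : ℕ) := List (Fin n × Bool)

/-- A nontrivial cyclic word: a nonempty cyclically ordered sequence of letters in which
no two consecutive letters are inverse to each other. -/
def CyclicWord (n : ℕ) :=
  {c : Cycle (Fin n × Bool) //
    c ≠ Cycle.nil ∧ c.Chain fun s t => ¬ (s.1 = t.1 ∧ s.2 = !t.2)}

section Graph

variable {n : ℕ} {F : Type*} [Group F] (b : FreeGroupBasis (Fin n) F)

/-- The element of `F` spelled by a word in the free basis `b` and its inverses. -/
def evalWord (w : Word n) : F := b.repr.symm (FreeGroup.mk w)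

/-- The cyclic word `w` is elliptic to the class `c`: an element spelled by a linear reading
of `w` is elliptic to a splitting in `c`. -/
def CyclicWord.IsEllipticTo (w : CyclicWord n) (c : SplittingClass F) : Prop :=
  ∃ (S : ProperFreeSplitting F) (l : Word n), (Quotient.mk _ S : SplittingClass F) = c ∧
    (l : Cycle (Fin n × Bool)) = w.1 ∧ IsElliptic S.left S.right (evalWord b l)

/-- The ellipticity graph: the bipartite graph on classes of proper free splittings and
nontrivial cyclic words, a class and a word being adjacent when the word is elliptic to
the class. -/
def ellipticityGraph : SimpleGraph (SplittingClass F ⊕ CyclicWord n) :=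
  SimpleGraph.fromRel fun u v => ∃ (c : SplittingClass F) (w : CyclicWord n),
    u = Sum.inl c ∧ v = Sum.inr w ∧ w.IsEllipticTo b c

/-- The finite data by which a pair of subgroups is given to an algorithm: a finite list of
words for each of the two subgroups. -/
abbrev SplittingCode (n : ℕ) := List (Word n) × List (Word n)

/-- The two lists of words in `p` generate `A` and `B` respectively. -/
def Presents (p : SplittingCode n) (A B : Subgroup F) : Prop :=
  Subgroup.closure {g | ∃ w ∈ p.1, evalWord b w = g} = A ∧
  Subgroup.closure {g | ∃ w ∈ p.2, evalWord b w = g} = B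

end Graph

end EllipticityGraph

/-! A common elliptic element exists exactly when some factor of one splitting and some factor of
the other have conjugates that meet nontrivially. Factors of free splittings are finitely generated,
so this is a question about subgroups `H`, `K` of a free group given by finite lists of words, and
`conjMeet_iff` reduces it to a bounded search.

The search rests on the finite set of cosets `vH`, with `v` a suffix of a listed generator or empty
(vertices of a Stallings-type graph). By `staysIn_toWord`, every suffix of the reduced word of an
element of `H` represents a coset in this set. If conjugates of `g ≠ 1` lie in `H` and in `K`, the
reduced word of a high power of `g` has a long middle block untouched by both conjugations. Its
suffixes trace pairs of cosets in the product of the two finite sets. By pigeonhole a pair repeats,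
and the nonempty subword `t` read in between fixes a coset of `H` and one of `K`. Thus `t` is
nontrivial, short, and conjugate into both by short words.

Membership in `H` is decided through finite actions (`wordMem_iff`): the partial action on finitely
many suffix cosets extends to permutations, so a word outside `H` moves a point that the generators
of `H` fix. All searches are bounded, hence primitive recursive.

For the graph, nontrivial conjugacy classes correspond to cyclic words, so a shared elliptic element
is a shared neighbour. -/

namespace EllipticityGraph

/-! ### Enumeration of bounded lists. -/

section Enumeration

variable {α : Type*}

/-- All lists of length at most `k` with entries in `l`. -/
def allLists (l : List α) : ℕ → List (List α)
  | 0 => [[]]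
  | k + 1 => [] :: (allLists l k).flatMap fun t => l.map fun x => x :: t

theorem mem_allLists {l : List α} {k : ℕ} {t : List α} :
    t ∈ allLists l k ↔ t.length ≤ k ∧ ∀ x ∈ t, x ∈ l := by
  induction k generalizing t with
  | zero => cases t <;> simp [allLists]
  | succ k ih => cases t <;> simp [allLists, ih]; tauto

theorem primrec_allLists [Primcodable α] :
    Primrec₂ (allLists : List α → ℕ → List (List α)) := by
  have h : Primrec₂ fun (l : List α) (k : ℕ) => (Nat.rec [[]]
      (fun _ ih => [] :: ih.flatMap fun t => l.map fun x => x :: t) k : List (List α)) := by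
    refine Primrec.nat_rec (f := fun _ : List α => [[]])
      (g := fun l x => [] :: x.2.flatMap fun t => l.map fun x => x :: t) (Primrec.const _) ?_
    refine Primrec.list_cons.comp (Primrec.const _) ?_
    refine Primrec.list_flatMap (Primrec.snd.comp Primrec.snd) ?_
    refine Primrec.list_map (Primrec.fst.comp Primrec.fst) ?_
    exact Primrec.list_cons.comp Primrec.snd (Primrec.snd.comp Primrec.fst)
  refine h.of_eq fun l k => ?_
  induction k with
  | zero => rfl
  | succ k ih => simp only [allLists, ← ih]

end Enumeration

/-! ### Bounded quantifiers and implication preserve primitive recursiveness. -/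

section PrimrecClosure

variable {α β : Type*} [Primcodable α] [Primcodable β]

theorem primrecPred_ball {f : α → List β} {p : α → β → Prop} (hf : Primrec f)
    (hp : PrimrecRel p) : PrimrecPred fun a => ∀ b ∈ f a, p a b :=
  (PrimrecRel.forall_mem_list (R := fun b a => p a b) (hp.comp Primrec.snd Primrec.fst)).comp
    hf Primrec.id

theorem primrecPred_bex {f : α → List β} {p : α → β → Prop} (hf : Primrec f)
    (hp : PrimrecRel p) : PrimrecPred fun a => ∃ b ∈ f a, p a b :=
  (PrimrecRel.exists_mem_list (R := fun b a => p a b) (hp.comp Primrec.snd Primrec.fst)).comp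
    hf Primrec.id

theorem primrecPred_imp {p q : α → Prop} (hp : PrimrecPred p) (hq : PrimrecPred q) :
    PrimrecPred fun a => p a → q a :=
  (hp.not.or hq).of_eq fun _ => imp_iff_not_or.symm

end PrimrecClosure

/-! ### The bounded searches and their primitive recursiveness. -/

section Tables

variable {n : ℕ}

/-- A list of all letters. -/
noncomputable def letters (n : ℕ) : List (Fin n × Bool) := Finset.univ.toList

/-- The arguments of a transition table with states `0, …, m - 1`, in a fixed order. -/
noncomputable def tableKeys (n m : ℕ) : List (ℕ × Fin n × Bool) :=
  (List.range m).flatMap fun s => (letters n).map fun a => (s, a)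

/-- The state reached from `s` by the letter `a`, for a table with values `T`. -/
noncomputable def tableStep (m : ℕ) (T : List ℕ) (s : ℕ) (a : Fin n × Bool) : ℕ :=
  T.getD (@List.idxOf _ instBEqOfDecidableEq (s, a) (tableKeys n m)) 0

/-- The state reached from `s` by the word `w`, its last letter acting first. -/
noncomputable def tableRun (m : ℕ) (T : List ℕ) (w : Word n) (s : ℕ) : ℕ :=
  w.foldr (fun a t => tableStep m T t a) s

/-- The table describes an action of the free group on `{0, …, m - 1}`. -/
def IsActionTable (n m : ℕ) (T : List ℕ) : Prop :=
  ∀ s ∈ List.range m, ∀ a ∈ letters n,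
    tableStep m T s a < m ∧ tableStep m T (tableStep m T s a) (a.1, !a.2) = s

/-- The number of pairs of a word in the list and one of its suffixes. -/
def wordsSize (W : List (Word n)) : ℕ := W.flatten.length + W.length

/-- All action tables with `wordsSize (u :: W)` states in which the words of `W` fix a state
have `u` fix that state. -/
def WordMem (W : List (Word n)) (u : Word n) : Prop :=
  ∀ T ∈ allLists (List.range (wordsSize (u :: W))) (tableKeys n (wordsSize (u :: W))).length,
    IsActionTable n (wordsSize (u :: W)) T → ∀ s ∈ List.range (wordsSize (u :: W)),
      (∀ g ∈ W, tableRun (wordsSize (u :: W)) T g s = s) →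
        tableRun (wordsSize (u :: W)) T u s = s

/-- A bounded search for a word that is nontrivial and has conjugates in the subgroups
generated by `W` and by `K`. -/
def ConjMeet (W K : List (Word n)) : Prop :=
  ∃ w ∈ allLists (letters n) (wordsSize ([] :: W) * wordsSize ([] :: K)),
    ¬ WordMem [] w ∧
    (∃ p ∈ allLists (letters n) (wordsSize ([] :: W) * wordsSize ([] :: K)),
      WordMem W (FreeGroup.invRev p ++ (w ++ p))) ∧
    ∃ p ∈ allLists (letters n) (wordsSize ([] :: W) * wordsSize ([] :: K)),
      WordMem K (FreeGroup.invRev p ++ (w ++ p))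

theorem primrec_tableKeys : Primrec (tableKeys n) := by
  refine Primrec.list_flatMap Primrec.list_range ?_
  refine Primrec.list_map (Primrec.const _) ?_
  exact (Primrec.snd.comp Primrec.fst).pair Primrec.snd

theorem primrec_tableStep :
    Primrec fun x : (ℕ × List ℕ) × ℕ × Fin n × Bool => tableStep x.1.1 x.1.2 x.2.1 x.2.2 :=
  (Primrec.list_getD 0).comp (Primrec.snd.comp Primrec.fst)
    (Primrec.list_idxOf.comp Primrec.snd
      (primrec_tableKeys.comp (Primrec.fst.comp Primrec.fst)))

theorem primrec_tableRun :
    Primrec fun x : (ℕ × List ℕ) × Word n × ℕ => tableRun x.1.1 x.1.2 x.2.1 x.2.2 := by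
  refine Primrec.list_foldr (h := fun (x : (ℕ × List ℕ) × Word n × ℕ) y => tableStep x.1.1 x.1.2 y.2 y.1)
    (Primrec.fst.comp Primrec.snd) (Primrec.snd.comp Primrec.snd) ?_
  exact primrec_tableStep.comp ((Primrec.fst.comp Primrec.fst).pair
    ((Primrec.snd.comp Primrec.snd).pair (Primrec.fst.comp Primrec.snd)))

theorem primrecPred_isActionTable :
    PrimrecPred fun x : ℕ × List ℕ => IsActionTable n x.1 x.2 := by
  refine primrecPred_ball (Primrec.list_range.comp Primrec.fst) ?_
  refine primrecPred_ball (Primrec.const _) ?_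
  have hstep : Primrec fun y : ((ℕ × List ℕ) × ℕ) × Fin n × Bool =>
      tableStep y.1.1.1 y.1.1.2 y.1.2 y.2 :=
    primrec_tableStep.comp ((Primrec.fst.comp Primrec.fst).pair
      ((Primrec.snd.comp Primrec.fst).pair Primrec.snd))
  refine (Primrec.nat_lt.comp hstep
    (Primrec.fst.comp (Primrec.fst.comp Primrec.fst))).and
    (Primrec.eq.comp (primrec_tableStep.comp ((Primrec.fst.comp Primrec.fst).pair
      (hstep.pair ?_))) (Primrec.snd.comp Primrec.fst))
  exact (Primrec.fst.comp Primrec.snd).pair (Primrec.not.comp (Primrec.snd.comp Primrec.snd))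

theorem primrec_wordsSize : Primrec (wordsSize : List (Word n) → ℕ) :=
  Primrec.nat_add.comp (Primrec.list_length.comp Primrec.list_flatten) Primrec.list_length

theorem primrecRel_wordMem : PrimrecRel (WordMem : List (Word n) → Word n → Prop) := by
  have hm : Primrec fun x : List (Word n) × Word n => wordsSize (x.2 :: x.1) :=
    primrec_wordsSize.comp (Primrec.list_cons.comp Primrec.snd Primrec.fst)
  refine primrecPred_ball (primrec_allLists.comp (Primrec.list_range.comp hm)
    (Primrec.list_length.comp (primrec_tableKeys.comp hm))) ?_
  refine primrecPred_imp (primrecPred_isActionTable.comp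
    ((hm.comp Primrec.fst).pair Primrec.snd)) ?_
  refine primrecPred_ball (Primrec.list_range.comp (hm.comp Primrec.fst)) ?_
  have hmT : Primrec fun x : ((List (Word n) × Word n) × List ℕ) × ℕ =>
      (wordsSize (x.1.1.2 :: x.1.1.1), x.1.2) :=
    (hm.comp (Primrec.fst.comp Primrec.fst)).pair (Primrec.snd.comp Primrec.fst)
  refine primrecPred_imp (primrecPred_ball
    (Primrec.fst.comp (Primrec.fst.comp Primrec.fst)) ?_) ?_
  · exact Primrec.eq.comp (primrec_tableRun.comp ((hmT.comp Primrec.fst).pair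
      (Primrec.snd.pair (Primrec.snd.comp Primrec.fst)))) (Primrec.snd.comp Primrec.fst)
  · exact Primrec.eq.comp (primrec_tableRun.comp (hmT.pair
      ((Primrec.snd.comp (Primrec.fst.comp Primrec.fst)).pair Primrec.snd))) Primrec.snd

theorem primrec_invRev : Primrec (FreeGroup.invRev : Word n → Word n) := by
  refine Primrec.list_reverse.comp (Primrec.list_map Primrec.id ?_)
  exact (Primrec.fst.comp Primrec.snd).pair (Primrec.not.comp (Primrec.snd.comp Primrec.snd))

theorem primrecRel_conjMeet :
    PrimrecRel (ConjMeet : List (Word n) → List (Word n) → Prop) := by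
  have hsize : Primrec fun W : List (Word n) => wordsSize ([] :: W) :=
    primrec_wordsSize.comp (Primrec.list_cons.comp (Primrec.const _) Primrec.id)
  have hall : Primrec fun x : List (Word n) × List (Word n) =>
      allLists (letters n) (wordsSize ([] :: x.1) * wordsSize ([] :: x.2)) :=
    primrec_allLists.comp (Primrec.const _)
      (Primrec.nat_mul.comp (hsize.comp Primrec.fst) (hsize.comp Primrec.snd))
  have hconj : Primrec fun x : ((List (Word n) × List (Word n)) × Word n) × Word n =>
      FreeGroup.invRev x.2 ++ (x.1.2 ++ x.2) :=
    Primrec.list_append.comp (primrec_invRev.comp Primrec.snd)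
      (Primrec.list_append.comp (Primrec.snd.comp Primrec.fst) Primrec.snd)
  refine primrecPred_bex hall ?_
  refine (primrecRel_wordMem.comp (Primrec.const _) Primrec.snd).not.and
    ((primrecPred_bex (hall.comp Primrec.fst) ?_).and
      (primrecPred_bex (hall.comp Primrec.fst) ?_))
  · exact primrecRel_wordMem.comp (Primrec.fst.comp (Primrec.fst.comp Primrec.fst)) hconj
  · exact primrecRel_wordMem.comp (Primrec.snd.comp (Primrec.fst.comp Primrec.fst)) hconj

end Tables

/-! ### Action tables as permutation actions of the free group. -/

section Tables

variable {n m : ℕ}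

theorem mem_letters (a : Fin n × Bool) : a ∈ letters n := by simp [letters]

theorem mem_tableKeys {k : ℕ × Fin n × Bool} : k ∈ tableKeys n m ↔ k.1 < m := by
  rcases k with ⟨s, a⟩
  simp [tableKeys, mem_letters]

theorem getD_map_idxOf {α β : Type*} [DecidableEq α] (l : List α) (f : α → β) {k : α} (d : β)
    (hk : k ∈ l) : (l.map f).getD (@List.idxOf _ instBEqOfDecidableEq k l) d = f k := by
  have h : List.idxOf k l < l.length := List.idxOf_lt_length_of_mem hk
  rw [List.getD_eq_getElem _ _ (by simpa using h), List.getElem_map, List.getElem_idxOf]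

theorem lift_mk_cons {G : Type*} [Group G] (τ : Fin n → G) (a : Fin n × Bool) (w : Word n) :
    FreeGroup.lift τ (FreeGroup.mk (a :: w)) =
      cond a.2 (τ a.1) (τ a.1)⁻¹ * FreeGroup.lift τ (FreeGroup.mk w) := by
  simp [FreeGroup.lift_mk]

theorem tableRun_eq_of_step {T : List ℕ} {τ : Fin n → Equiv.Perm (Fin m)}
    (h : ∀ (a : Fin n × Bool) (s : Fin m),
      tableStep m T s a = (cond a.2 (τ a.1) (τ a.1)⁻¹ : Equiv.Perm (Fin m)) s)
    (w : Word n) (s : Fin m) :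
    tableRun m T w s = (FreeGroup.lift τ (FreeGroup.mk w) s : Fin m) := by
  induction w with
  | nil => simp [tableRun, FreeGroup.lift_mk]
  | cons a w ih =>
    rw [lift_mk_cons, Equiv.Perm.mul_apply, ← h, ← ih]
    rfl

theorem IsActionTable.exists_perm {T : List ℕ} (hT : IsActionTable n m T) :
    ∃ τ : Fin n → Equiv.Perm (Fin m), ∀ (w : Word n) (s : Fin m),
      tableRun m T w s = (FreeGroup.lift τ (FreeGroup.mk w) s : Fin m) := by
  have h1 : ∀ (s : Fin m) (a : Fin n × Bool), tableStep m T s a < m :=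
    fun s a => (hT s (by simp) a (mem_letters a)).1
  have h2 : ∀ (s : Fin m) (a : Fin n × Bool),
      tableStep m T (tableStep m T s a) (a.1, !a.2) = s :=
    fun s a => (hT s (by simp) a (mem_letters a)).2
  let τ : Fin n → Equiv.Perm (Fin m) := fun i =>
    { toFun := fun s => ⟨tableStep m T s (i, true), h1 s _⟩
      invFun := fun s => ⟨tableStep m T s (i, false), h1 s _⟩
      left_inv := fun s => Fin.ext (h2 s (i, true))
      right_inv := fun s => Fin.ext (h2 s (i, false)) }
  refine ⟨τ, tableRun_eq_of_step ?_⟩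
  rintro ⟨i, _ | _⟩ s <;> rfl

theorem exists_isActionTable (τ : Fin n → Equiv.Perm (Fin m)) :
    ∃ T ∈ allLists (List.range m) (tableKeys n m).length, IsActionTable n m T ∧
      ∀ (w : Word n) (s : Fin m),
        tableRun m T w s = (FreeGroup.lift τ (FreeGroup.mk w) s : Fin m) := by
  -- The value `0` outside the range is only a filler: every key of the table has its state below
  -- `m`.
  let δ : ℕ × Fin n × Bool → ℕ := fun k => if h : k.1 < m then
    ((cond k.2.2 (τ k.2.1) (τ k.2.1)⁻¹ : Equiv.Perm (Fin m)) ⟨k.1, h⟩ : Fin m) else 0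
  have hstep : ∀ (a : Fin n × Bool) (s : Fin m),
      tableStep m ((tableKeys n m).map δ) s a =
        (cond a.2 (τ a.1) (τ a.1)⁻¹ : Equiv.Perm (Fin m)) s := by
    intro a s
    rw [tableStep, getD_map_idxOf _ _ _ (mem_tableKeys.2 s.2)]
    simp [δ]
  refine ⟨(tableKeys n m).map δ, mem_allLists.2 ⟨by simp, ?_⟩, ?_, tableRun_eq_of_step hstep⟩
  · intro x hx
    obtain ⟨k, hk, rfl⟩ := List.mem_map.1 hx
    have hk' := mem_tableKeys.1 hk
    simp [δ, hk']
  · intro s hs a _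
    have h := hstep a ⟨s, List.mem_range.1 hs⟩
    simp only at h
    rw [h, hstep]
    refine ⟨Fin.is_lt _, ?_⟩
    rcases a with ⟨i, _ | _⟩ <;> simp

theorem wordMem_iff_forall_perm {W : List (Word n)} {u : Word n} (hm : wordsSize (u :: W) = m) :
    WordMem W u ↔ ∀ (τ : Fin n → Equiv.Perm (Fin m)) (s : Fin m),
      (∀ g ∈ W, FreeGroup.lift τ (FreeGroup.mk g) s = s) →
        FreeGroup.lift τ (FreeGroup.mk u) s = s := by
  unfold WordMem
  rw [hm]
  constructor
  · intro h τ s hs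
    obtain ⟨T, hT, hT1, hT2⟩ := exists_isActionTable τ
    have := h T hT hT1 s (by simp) fun g hg => by rw [hT2, hs g hg]
    rw [hT2] at this
    exact Fin.ext this
  · intro h T _ hT s hs hg
    obtain ⟨τ, hτ⟩ := hT.exists_perm
    have hs' := List.mem_range.1 hs
    have hrun : ∀ w : Word n, tableRun m T w s = _ := fun w => hτ w ⟨s, hs'⟩
    rw [hrun, h τ ⟨s, hs'⟩]
    intro g hgW
    exact Fin.ext ((hrun g).symm.trans (hg g hgW))

end Tables

/-! ### Deciding membership in a finitely generated subgroup. -/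

section Membership

theorem exists_injOn_fin {α : Type*} {V : Set α} {m : ℕ} (hV : V.Finite) (hm : V.ncard ≤ m)
    (h0 : 0 < m) : ∃ ι : α → Fin m, Set.InjOn ι V := by
  classical
  have := hV.fintype
  have hc : Fintype.card V ≤ m := by rwa [← Nat.card_coe_set_eq, Nat.card_eq_fintype_card] at hm
  refine ⟨fun c => if h : c ∈ V then Fin.castLE hc (Fintype.equivFin V ⟨c, h⟩) else ⟨0, h0⟩, ?_⟩
  intro a ha b hb hab
  simp only [ha, hb, dif_pos] at hab
  simpa using hab

/-- The rule `ι v ↦ ι (σ v)` is an injection between subsets of `Fin m`, and an injection from part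
of a finite set to that set extends to a permutation. -/
theorem exists_perm_extending {α : Type*} {V : Set α} {m : ℕ} {ι : α → Fin m}
    (hι : Set.InjOn ι V) (σ : Equiv.Perm α) :
    ∃ τ : Equiv.Perm (Fin m), ∀ v ∈ V, σ v ∈ V → τ (ι v) = ι (σ v) := by
  classical
  rcases isEmpty_or_nonempty α with hα | hα
  · exact ⟨1, fun v => isEmptyElim v⟩
  have hinv : ∀ v ∈ V, Function.invFunOn ι V (ι v) = v := fun v hv => hι.leftInvOn_invFunOn hv
  obtain ⟨g, hg⟩ := Finset.exists_equiv_extend_of_card_eq (α := Fin m) (β := Fin m)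
    (t := Finset.univ) (by simp)
    (s := Finset.univ.filter fun i => ∃ v ∈ V, σ v ∈ V ∧ ι v = i)
    (f := fun i => ι (σ (Function.invFunOn ι V i))) (Finset.subset_univ _) (by
      intro i hi j hj hij
      simp only [Finset.coe_filter, Finset.mem_univ, true_and, Set.mem_ofPred_eq] at hi hj
      obtain ⟨v, hv, hv', rfl⟩ := hi
      obtain ⟨w, hw, hw', rfl⟩ := hj
      simp only [hinv v hv, hinv w hw] at hij
      rw [σ.injective (hι hv' hw' hij)])
  refine ⟨g.trans (Equiv.subtypeUnivEquiv Finset.mem_univ), fun v hv hv' => ?_⟩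
  have := hg (ι v) (by simp only [Finset.mem_filter, Finset.mem_univ, true_and]; exact ⟨v, hv, hv', rfl⟩)
  simpa [hinv v hv] using this

variable {n : ℕ}

/-- The subgroup generated by the elements spelled by the words in `W`. -/
def wordsSubgroup (W : List (Word n)) : Subgroup (FreeGroup (Fin n)) :=
  Subgroup.closure {g | ∃ w ∈ W, FreeGroup.mk w = g}

theorem mk_mem_wordsSubgroup {W : List (Word n)} {w : Word n} (hw : w ∈ W) :
    FreeGroup.mk w ∈ wordsSubgroup W :=
  Subgroup.subset_closure ⟨w, hw, rfl⟩

/-- The left cosets of `H` represented by the suffixes of the words in `W`. -/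
def suffixCosets (H : Subgroup (FreeGroup (Fin n))) (W : List (Word n)) :
    Set (FreeGroup (Fin n) ⧸ H) :=
  {c | ∃ g ∈ W, ∃ v, v <:+ g ∧ (FreeGroup.mk v : FreeGroup (Fin n) ⧸ H) = c}

theorem suffixCosets_eq (H : Subgroup (FreeGroup (Fin n))) (W : List (Word n)) :
    suffixCosets H W = (fun v => ((FreeGroup.mk v : FreeGroup (Fin n)) : FreeGroup (Fin n) ⧸ H)) ''
      ((W.flatMap List.tails).toFinset : Set (Word n)) := by
  ext c
  simp only [suffixCosets, Set.mem_ofPred_eq, Set.mem_image, List.coe_toFinset, List.mem_flatMap,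
    List.mem_tails]
  grind

theorem suffixCosets_finite (H : Subgroup (FreeGroup (Fin n))) (W : List (Word n)) :
    (suffixCosets H W).Finite := by
  rw [suffixCosets_eq]
  exact (Finset.finite_toSet _).image _

/-- A word of length `ℓ` has `ℓ + 1` suffixes; this is the source of the formula for `wordsSize`. -/
theorem length_flatMap_tails {α : Type*} (W : List (List α)) :
    (W.flatMap List.tails).length = W.flatten.length + W.length := by
  induction W with
  | nil => rfl
  | cons w W ih => simp [ih]; omega

theorem ncard_suffixCosets_le (H : Subgroup (FreeGroup (Fin n))) (W : List (Word n)) :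
    (suffixCosets H W).ncard ≤ wordsSize W := by
  rw [suffixCosets_eq, wordsSize, ← length_flatMap_tails]
  refine (Set.ncard_image_le (Finset.finite_toSet _)).trans ?_
  rw [Set.ncard_coe_finset]
  exact List.toFinset_card_le _

/-- Reading a listed word from its right end, starting at the trivial coset, never leaves the suffix
cosets, where `τ` imitates left multiplication. -/
theorem perm_lift_apply_of_suffix {H : Subgroup (FreeGroup (Fin n))} {W : List (Word n)} {m : ℕ}
    {ι : FreeGroup (Fin n) ⧸ H → Fin m} {τ : Fin n → Equiv.Perm (Fin m)}
    (hτ : ∀ i, ∀ v ∈ suffixCosets H W, FreeGroup.of i • v ∈ suffixCosets H W →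
      τ i (ι v) = ι (FreeGroup.of i • v)) {g : Word n} (hg : g ∈ W) {v : Word n} (hv : v <:+ g) :
    FreeGroup.lift τ (FreeGroup.mk v) (ι ((1 : FreeGroup (Fin n)) : FreeGroup (Fin n) ⧸ H)) =
      ι ((FreeGroup.mk v : FreeGroup (Fin n)) : FreeGroup (Fin n) ⧸ H) := by
  induction v with
  | nil => simp [FreeGroup.lift_mk, FreeGroup.one_eq_mk]
  | cons a v ih =>
    have hv' : v <:+ g := (List.suffix_cons a v).trans hv
    rw [lift_mk_cons, Equiv.Perm.mul_apply, ih hv']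
    have h1 : ((FreeGroup.mk v : FreeGroup (Fin n)) : FreeGroup (Fin n) ⧸ H) ∈
      suffixCosets H W := ⟨g, hg, v, hv', rfl⟩
    have h2 : ((FreeGroup.mk (a :: v) : FreeGroup (Fin n)) : FreeGroup (Fin n) ⧸ H) ∈
      suffixCosets H W := ⟨g, hg, _, hv, rfl⟩
    rcases a with ⟨i, _ | _⟩
    -- Only positive generators are constrained by `hτ`, so for an inverse letter the edge is
    -- traversed from its far end and inverted.
    · have h3 : FreeGroup.of i •
          ((FreeGroup.mk ((i, false) :: v) : FreeGroup (Fin n)) : FreeGroup (Fin n) ⧸ H) =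
          ((FreeGroup.mk v : FreeGroup (Fin n)) : FreeGroup (Fin n) ⧸ H) := by
        rw [MulAction.Quotient.smul_coe, smul_eq_mul, FreeGroup.of, FreeGroup.mul_mk]
        congr 1
        exact Quot.sound (FreeGroup.Red.Step.not (L₁ := []))
      have h4 := hτ i _ h2 (by rwa [h3])
      rw [h3] at h4
      simp only [cond_false, Equiv.Perm.inv_eq_iff_eq]
      exact h4.symm
    · exact hτ i _ h1 h2

/-- If `u` lies in the subgroup, it fixes whatever the generators fix. Otherwise the action on
suffix cosets, transported to `Fin m` and completed to permutations, fixes the base point under `W`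
but not under `u`. -/
theorem wordMem_iff (W : List (Word n)) (u : Word n) :
    WordMem W u ↔ FreeGroup.mk u ∈ wordsSubgroup W := by
  rw [wordMem_iff_forall_perm rfl]
  constructor
  · intro h
    have hpos : 0 < wordsSize (u :: W) := by simp [wordsSize]
    obtain ⟨ι, hι⟩ := exists_injOn_fin (suffixCosets_finite (wordsSubgroup W) (u :: W))
      (ncard_suffixCosets_le _ _) hpos
    choose τ hτ using fun i : Fin n =>
      exists_perm_extending hι (MulAction.toPerm (FreeGroup.of i))
    have hrun := fun g (hg : g ∈ u :: W) =>
      perm_lift_apply_of_suffix hτ hg (List.suffix_refl g)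
    have hu := h τ (ι ((1 : FreeGroup (Fin n)) : _ ⧸ wordsSubgroup W)) (by
      intro g hg
      rw [hrun g (by simp [hg])]
      congr 1
      exact QuotientGroup.eq.2 (by simpa using inv_mem (mk_mem_wordsSubgroup hg)))
    rw [hrun u (by simp)] at hu
    have := hι ⟨u, by simp, u, List.suffix_refl u, rfl⟩
      ⟨u, by simp, [], List.nil_suffix, rfl⟩ hu
    simpa using inv_mem (QuotientGroup.eq.1 this)
  · intro h τ s hs
    have : wordsSubgroup W ≤
        (MulAction.stabilizer (Equiv.Perm (Fin (wordsSize (u :: W)))) s).comap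
          (FreeGroup.lift τ) := by
      rw [wordsSubgroup, Subgroup.closure_le]
      rintro _ ⟨w, hw, rfl⟩
      exact hs w hw
    exact this h

end Membership

/-! ### Limited cancellation in reduced words. -/

section ReducedWords

variable {α : Type*} [DecidableEq α]

/-- Each letter of `X` put in front cancels at most one letter of `L`. -/
theorem drop_length_suffix_reduce_append (X : List (α × Bool)) {L : List (α × Bool)}
    (hL : FreeGroup.IsReduced L) : L.drop X.length <:+ FreeGroup.reduce (X ++ L) := by
  induction X with
  | nil => simp [hL.reduce_eq]
  | cons a X ih =>
    rw [List.length_cons, ← List.tail_drop, List.cons_append, FreeGroup.reduce.cons]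
    have hs : (L.drop X.length).tail <:+ L.drop X.length := List.tail_suffix _
    generalize L.drop X.length = D at ih hs
    generalize FreeGroup.reduce (X ++ L) = R at ih
    cases R with
    | nil => exact (hs.trans ih).trans (List.nil_suffix)
    | cons b R =>
      dsimp only
      split_ifs
      · rcases List.suffix_cons_iff.1 ih with rfl | h
        · exact List.suffix_refl _
        · exact hs.trans h
      · exact (hs.trans ih).trans (List.suffix_cons _ _)

theorem drop_suffix_toWord_mul (x g : FreeGroup α) :
    g.toWord.drop x.toWord.length <:+ (x * g).toWord := by
  rw [FreeGroup.toWord_mul]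
  exact drop_length_suffix_reduce_append _ FreeGroup.isReduced_toWord

theorem suffix_toWord_mul {x g : FreeGroup α} {p q : List (α × Bool)}
    (hg : g.toWord = p ++ q) (hx : x.toWord.length ≤ p.length) : q <:+ (x * g).toWord := by
  refine List.IsSuffix.trans ?_ (drop_suffix_toWord_mul x g)
  rw [hg, List.drop_append_of_le_length hx]
  exact List.suffix_append _ _

theorem prefix_toWord_mul {y g : FreeGroup α} {p q : List (α × Bool)}
    (hg : g.toWord = p ++ q) (hy : y.toWord.length ≤ q.length) : p <+: (g * y).toWord := by
  have h : FreeGroup.invRev p <:+ (y⁻¹ * g⁻¹).toWord := by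
    refine suffix_toWord_mul (p := FreeGroup.invRev q) ?_ ?_
    · rw [FreeGroup.toWord_inv, hg, FreeGroup.invRev_append]
    · rwa [FreeGroup.toWord_inv, FreeGroup.invRev_length, FreeGroup.invRev_length]
  rw [← mul_inv_rev, FreeGroup.toWord_inv] at h
  obtain ⟨t, ht⟩ := h
  refine ⟨FreeGroup.invRev t, ?_⟩
  rw [← FreeGroup.invRev_invRev (L₁ := (g * y).toWord), ← ht, FreeGroup.invRev_append,
    FreeGroup.invRev_invRev]

/-- The factors `x` and `y` are too short to cancel into `q`, so `q` survives in the product,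
followed by a word `t` spelling `r * y`; the suffix sought is `v ++ t`. -/
theorem exists_suffix_toWord_mul_mul {x y g : FreeGroup α} {p q r : List (α × Bool)}
    (hg : g.toWord = p ++ (q ++ r)) (hx : x.toWord.length ≤ p.length)
    (hy : y.toWord.length ≤ r.length) {v : List (α × Bool)} (hv : v <:+ q) :
    ∃ s, s <:+ (x * g * y).toWord ∧ FreeGroup.mk s = FreeGroup.mk v * (FreeGroup.mk r * y) := by
  obtain ⟨t, ht⟩ := prefix_toWord_mul (p := p ++ q) (by rw [hg, List.append_assoc]) hy
  have h1 : q ++ t <:+ (x * (g * y)).toWord :=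
    suffix_toWord_mul (p := p) (by rw [← ht, List.append_assoc]) hx
  obtain ⟨u, rfl⟩ := hv
  refine ⟨v ++ t, ?_, ?_⟩
  · rw [mul_assoc]
    exact List.IsSuffix.trans ⟨u, by simp⟩ h1
  · have h2 : FreeGroup.mk t = FreeGroup.mk r * y := by
      have h3 : FreeGroup.mk (p ++ (u ++ v)) * FreeGroup.mk t =
          FreeGroup.mk (p ++ (u ++ v)) * (FreeGroup.mk r * y) := by
        rw [← mul_assoc, FreeGroup.mul_mk, FreeGroup.mul_mk, ht, FreeGroup.mk_toWord]
        congr 1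
        rw [← FreeGroup.mk_toWord (x := g), hg]
        simp
      exact mul_left_cancel h3
    rw [← h2, FreeGroup.mul_mk]

/-- Free groups are torsion-free, so the powers of `g` are distinct, while only finitely many words
have bounded length. -/
theorem exists_le_length_toWord_pow [Finite α] {g : FreeGroup α} (hg : g ≠ 1) (k : ℕ) :
    ∃ m, k ≤ (g ^ m).toWord.length := by
  by_contra! h
  have hinj : Function.Injective fun m : ℕ => (g ^ m).toWord :=
    FreeGroup.toWord_injective.comp
      (injective_pow_iff_not_isOfFinOrder.2 (not_isOfFinOrder_of_isMulTorsionFree hg))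
  exact Set.infinite_range_of_injective hinj ((List.finite_length_le (α × Bool) k).subset
    (by rintro _ ⟨m, rfl⟩; exact (h m).le))

end ReducedWords

/-! ### Suffix cosets of subgroup elements and the bounded search for common conjugates. -/

section Core

variable {n : ℕ}

/-- All suffixes of `w` represent cosets in `V`. -/
def StaysIn {H : Subgroup (FreeGroup (Fin n))} (V : Set (FreeGroup (Fin n) ⧸ H))
    (w : Word n) : Prop :=
  ∀ v, v <:+ w → ((FreeGroup.mk v : FreeGroup (Fin n)) : FreeGroup (Fin n) ⧸ H) ∈ V

variable {H : Subgroup (FreeGroup (Fin n))} {V : Set (FreeGroup (Fin n) ⧸ H)}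

theorem coe_mul_of_mem (g : FreeGroup (Fin n)) {h : FreeGroup (Fin n)} (hh : h ∈ H) :
    ((g * h : FreeGroup (Fin n)) : FreeGroup (Fin n) ⧸ H) = g :=
  QuotientGroup.mk_mul_of_mem g hh

/-- A suffix reaching into `w₁` has the form `a ++ w₂`, and `w₂` is absorbed by `H`. -/
theorem StaysIn.append {w₁ w₂ : Word n} (h₁ : StaysIn V w₁) (h₂ : StaysIn V w₂)
    (hH : FreeGroup.mk w₂ ∈ H) : StaysIn V (w₁ ++ w₂) := by
  rintro v ⟨t, ht⟩
  rcases List.append_eq_append_iff.1 ht with ⟨a, rfl, rfl⟩ | ⟨a, rfl, rfl⟩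
  · rw [← FreeGroup.mul_mk, coe_mul_of_mem _ hH]
    exact h₁ a (List.suffix_append _ _)
  · exact h₂ v (List.suffix_append _ _)

/-- A suffix of the inverse word is a suffix of `w` times the inverse of `w`, and the latter is
absorbed by `H`. -/
theorem StaysIn.invRev {w : Word n} (h : StaysIn V w) (hH : FreeGroup.mk w ∈ H) :
    StaysIn V (FreeGroup.invRev w) := by
  rintro v ⟨t, ht⟩
  have hw : w = FreeGroup.invRev v ++ FreeGroup.invRev t := by
    rw [← FreeGroup.invRev_append, ht, FreeGroup.invRev_invRev]
  have := h (FreeGroup.invRev t) (hw ▸ List.suffix_append _ _)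
  rw [← coe_mul_of_mem _ hH, hw, ← FreeGroup.mul_mk, ← FreeGroup.inv_mk (L := v),
    mul_inv_cancel_left]
  exact this

/-- Each suffix of the shortened word equals, in the group, a suffix of the longer one, so
cancellation creates no new coset. -/
theorem StaysIn.step {w₁ w₂ : Word n} (h : StaysIn V w₁) (hs : FreeGroup.Red.Step w₁ w₂) :
    StaysIn V w₂ := by
  obtain @⟨L₁, L₂, x, b⟩ := hs
  rintro v ⟨t, ht⟩
  rcases List.append_eq_append_iff.1 ht with ⟨a, rfl, rfl⟩ | ⟨a, rfl, rfl⟩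
  · have h1 := h (a ++ (x, b) :: (x, !b) :: L₂) ⟨t, by simp⟩
    have h2 : FreeGroup.mk (a ++ (x, b) :: (x, !b) :: L₂) = FreeGroup.mk (a ++ L₂) :=
      Quot.sound FreeGroup.Red.Step.not
    rwa [h2] at h1
  · exact h v ⟨L₁ ++ (x, b) :: (x, !b) :: a, by simp⟩

theorem StaysIn.red {w₁ w₂ : Word n} (h : StaysIn V w₁) (hr : FreeGroup.Red w₁ w₂) :
    StaysIn V w₂ := by
  induction hr with
  | refl => exact h
  | tail _ hs ih => exact ih.step hs

/-- It holds for an unreduced product of generators and their inverses, and free reduction preserves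
it. The extra empty word supplies the trivial coset even when `W` is empty. -/
theorem staysIn_toWord {W : List (Word n)} {h : FreeGroup (Fin n)} (hh : h ∈ wordsSubgroup W) :
    StaysIn (suffixCosets (wordsSubgroup W) ([] :: W)) h.toWord := by
  have key : ∃ w : Word n, FreeGroup.mk w = h ∧
      StaysIn (suffixCosets (wordsSubgroup W) ([] :: W)) w := by
    unfold wordsSubgroup at hh
    induction hh using Subgroup.closure_induction with
    | mem x hx =>
      obtain ⟨w, hw, rfl⟩ := hx
      exact ⟨w, rfl, fun v hv => ⟨w, by simp [hw], v, hv, rfl⟩⟩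
    | one => exact ⟨[], rfl, fun v hv => ⟨[], by simp, v, hv, rfl⟩⟩
    | mul x y _ hy ihx ihy =>
      obtain ⟨w₁, rfl, h₁⟩ := ihx
      obtain ⟨w₂, rfl, h₂⟩ := ihy
      exact ⟨w₁ ++ w₂, FreeGroup.mul_mk.symm, h₁.append h₂ hy⟩
    | inv x hx ih =>
      obtain ⟨w, rfl, h⟩ := ih
      exact ⟨_, FreeGroup.inv_mk.symm, h.invRev hx⟩
  obtain ⟨w, rfl, hw⟩ := key
  rw [FreeGroup.toWord_mk]
  exact hw.red FreeGroup.reduce.red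

theorem length_le_wordsSize {W : List (Word n)} {g v : Word n} (hg : g ∈ [] :: W)
    (hv : v <:+ g) : v.length ≤ wordsSize ([] :: W) := by
  refine hv.length_le.trans (le_trans ?_ (Nat.le_add_right _ _))
  exact (List.sublist_flatten_of_mem hg).length_le

/-- A fixed coset is represented by a suffix `p` of a listed word, which is short; fixing it means
that `p⁻¹ t p` lies in the subgroup. -/
theorem exists_conj_mem_of_fixed {W : List (Word n)} {z : FreeGroup (Fin n)} {t : Word n} {B : ℕ}
    (hB : wordsSize ([] :: W) ≤ B)
    (hz : (z : FreeGroup (Fin n) ⧸ wordsSubgroup W) ∈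
      suffixCosets (wordsSubgroup W) ([] :: W))
    (ht : ((FreeGroup.mk t * z : FreeGroup (Fin n)) : FreeGroup (Fin n) ⧸ wordsSubgroup W) = z) :
    ∃ p ∈ allLists (letters n) B, WordMem W (FreeGroup.invRev p ++ (t ++ p)) := by
  obtain ⟨g, hg, p, hp, hpz⟩ := hz
  refine ⟨p, mem_allLists.2 ⟨(length_le_wordsSize hg hp).trans hB, fun x _ => mem_letters x⟩, ?_⟩
  rw [wordMem_iff, ← FreeGroup.mul_mk, ← FreeGroup.mul_mk, ← FreeGroup.inv_mk]
  refine QuotientGroup.eq.1 ?_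
  have h := congrArg (fun c => FreeGroup.mk t • c) hpz
  simp only [MulAction.Quotient.smul_coe, smul_eq_mul] at h
  rw [h, ht, hpz]

theorem conjMeet_iff (W K : List (Word n)) : ConjMeet W K ↔
    ∃ g : FreeGroup (Fin n), g ≠ 1 ∧ (∃ x, x * g * x⁻¹ ∈ wordsSubgroup W) ∧
      ∃ y, y * g * y⁻¹ ∈ wordsSubgroup K := by
  constructor
  · rintro ⟨w, -, hw, ⟨p, -, hp⟩, q, -, hq⟩
    rw [wordMem_iff, ← FreeGroup.mul_mk, ← FreeGroup.mul_mk, ← FreeGroup.inv_mk,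
      ← mul_assoc] at hp hq
    refine ⟨FreeGroup.mk w, ?_, ⟨(FreeGroup.mk p)⁻¹, by simpa using hp⟩,
      (FreeGroup.mk q)⁻¹, by simpa using hq⟩
    intro h
    rw [wordMem_iff, h] at hw
    exact hw (one_mem _)
  · rintro ⟨g, hg, ⟨x, hx⟩, y, hy⟩
    set B := wordsSize ([] :: W) * wordsSize ([] :: K) with hB
    have hWpos : 0 < wordsSize ([] :: W) := by simp [wordsSize]
    have hKpos : 0 < wordsSize ([] :: K) := by simp [wordsSize]
    set k := max x.toWord.length y.toWord.length
    -- The power leaves room for a block `q` of length `B`, shielded on both sides by `k` letters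
    -- that absorb all cancellation with the conjugators.
    obtain ⟨m, hm⟩ := exists_le_length_toWord_pow hg (k + (B + k))
    obtain ⟨p, q, r, hw, hpk, hqB, hrk⟩ : ∃ p q r, (g ^ m).toWord = p ++ (q ++ r) ∧
        p.length = k ∧ q.length = B ∧ k ≤ r.length :=
      ⟨(g ^ m).toWord.take k, ((g ^ m).toWord.drop k).take B, ((g ^ m).toWord.drop k).drop B,
        by simp only [List.take_append_drop], by simp; omega, by simp; omega, by simp; omega⟩
    have hcoset : ∀ (Z : List (Word n)) (z : FreeGroup (Fin n)), z * g * z⁻¹ ∈ wordsSubgroup Z →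
        z.toWord.length ≤ k → ∀ v, v <:+ q →
          ((FreeGroup.mk v * (FreeGroup.mk r * z⁻¹) : FreeGroup (Fin n)) :
            FreeGroup (Fin n) ⧸ wordsSubgroup Z) ∈
            suffixCosets (wordsSubgroup Z) ([] :: Z) := by
      intro Z z hz hzk v hv
      obtain ⟨s, hs, hsv⟩ := exists_suffix_toWord_mul_mul (x := z) (y := z⁻¹) hw
        (by omega) (by rw [FreeGroup.toWord_inv, FreeGroup.invRev_length]; omega) hv
      rw [← hsv]
      refine staysIn_toWord ?_ s hs
      rw [← conj_pow]
      exact pow_mem hz m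
    have hcx := hcoset W x hx (le_max_left _ _)
    have hcy := hcoset K y hy (le_max_right _ _)
    -- The block `q` has `B + 1` suffixes, one more than the bound `B` on the number of coset pairs,
    -- so two of them give the same pair.
    obtain ⟨i, hi, j, hj, hij, heq⟩ := Set.exists_ne_map_eq_of_ncard_lt_of_maps_to
      (s := (Finset.range (B + 1) : Set ℕ))
      (t := suffixCosets (wordsSubgroup W) ([] :: W) ×ˢ suffixCosets (wordsSubgroup K) ([] :: K))
      (f := fun i => (((FreeGroup.mk (q.drop i) * (FreeGroup.mk r * x⁻¹) :
          FreeGroup (Fin n)) : FreeGroup (Fin n) ⧸ wordsSubgroup W),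
        ((FreeGroup.mk (q.drop i) * (FreeGroup.mk r * y⁻¹) :
          FreeGroup (Fin n)) : FreeGroup (Fin n) ⧸ wordsSubgroup K)))
      (by
        rw [Set.ncard_prod, Set.ncard_coe_finset, Finset.card_range]
        exact Nat.lt_succ_of_le (Nat.mul_le_mul (ncard_suffixCosets_le _ _)
          (ncard_suffixCosets_le _ _)))
      (fun i _ => ⟨hcx _ (List.drop_suffix _ _), hcy _ (List.drop_suffix _ _)⟩)
      ((suffixCosets_finite _ _).prod (suffixCosets_finite _ _))
    wlog hlt : i < j generalizing i j
    · exact this j hj i hi hij.symm heq.symm (by omega)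
    have hjB : j ≤ B := by simpa [Nat.lt_succ_iff] using hj
    obtain ⟨t, ht, htlen⟩ : ∃ t, q.drop i = t ++ q.drop j ∧ t.length = j - i := by
      refine ⟨(q.drop i).take (j - i), ?_, by simp; omega⟩
      conv_lhs => rw [← List.take_append_drop (j - i) (q.drop i)]
      rw [List.drop_drop, Nat.add_sub_cancel' hlt.le]
    simp only [Prod.mk.injEq, ht, ← FreeGroup.mul_mk (L₁ := t), mul_assoc] at heq
    refine ⟨t, mem_allLists.2 ⟨by omega, fun x _ => mem_letters x⟩, ?_,
      exists_conj_mem_of_fixed (Nat.le_mul_of_pos_right _ hKpos)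
        (hcx _ (List.drop_suffix j q)) heq.1,
      exists_conj_mem_of_fixed (Nat.le_mul_of_pos_left _ hWpos)
        (hcy _ (List.drop_suffix j q)) heq.2⟩
    -- A subword of a reduced word is reduced, so the nonempty `t` is nontrivial.
    have hred : FreeGroup.IsReduced t := by
      refine (FreeGroup.isReduced_toWord (x := g ^ m)).infix ?_
      have h1 : t <:+: q := List.IsInfix.trans ⟨[], q.drop j, by simp [ht]⟩
        (List.drop_suffix i q).isInfix
      refine h1.trans ⟨p, r, by simp [hw]⟩
    rw [wordMem_iff, wordsSubgroup]
    simp only [List.not_mem_nil, false_and, exists_false, Set.ofPred_false, Subgroup.closure_empty,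
      Subgroup.mem_bot]
    intro h1
    have h2 := congrArg FreeGroup.toWord h1
    rw [FreeGroup.toWord_mk, hred.reduce_eq, FreeGroup.toWord_one] at h2
    rw [h2] at htlen
    simp at htlen
    omega

end Core

/-! ### Finite generation of the factors of a free splitting. -/

section FiniteGeneration

variable {G : Type*} [Group G] {A B A' B' : Subgroup G}

/-- Elements `α b l β` with `α, β ∈ A'`, `1 ≠ b ∈ B'` and `l` a product `a₁b₁⋯aₖbₖ` of
nontrivial elements `aᵢ ∈ A'`, `bᵢ ∈ B'`. -/
def IsAlternating (A' B' : Subgroup G) (x : G) : Prop :=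
  ∃ α ∈ A', ∃ b ∈ B', b ≠ 1 ∧ ∃ l : List (A' × B'), (∀ p ∈ l, p.1 ≠ 1 ∧ p.2 ≠ 1) ∧
    ∃ β ∈ A', x = α * (b * ((l.map fun p => (p.1 : G) * (p.2 : G)).prod * β))

theorem mem_or_isAlternating_mul_left {a x : G} (ha : a ∈ A')
    (hx : x ∈ A' ∨ IsAlternating A' B' x) : a * x ∈ A' ∨ IsAlternating A' B' (a * x) := by
  rcases hx with hx | ⟨α, hα, b, hb, hb1, l, hl, β, hβ, rfl⟩
  · exact Or.inl (mul_mem ha hx)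
  · exact Or.inr ⟨a * α, mul_mem ha hα, b, hb, hb1, l, hl, β, hβ, (mul_assoc _ _ _).symm⟩

/-- If `α` is nontrivial, `b` starts a new syllable. If `α = 1`, it merges with the first
`B'`-syllable, and should that cancel, the next pair of `l` takes over the leading role. -/
theorem mem_or_isAlternating_mul_right_factor {b x : G} (hb : b ∈ B')
    (hx : x ∈ A' ∨ IsAlternating A' B' x) : b * x ∈ A' ∨ IsAlternating A' B' (b * x) := by
  by_cases hb1 : b = 1
  · simpa [hb1] using hx
  rcases hx with hx | ⟨α, hα, c, hc, hc1, l, hl, β, hβ, rfl⟩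
  · exact Or.inr ⟨1, one_mem _, b, hb, hb1, [], by simp, x, hx, by simp⟩
  by_cases hα1 : α = 1
  · subst hα1
    by_cases hbc : b * c = 1
    · cases l with
      | nil => exact Or.inl (by simpa [← mul_assoc, hbc] using hβ)
      | cons p l =>
        refine Or.inr ⟨p.1, p.1.2, p.2, p.2.2, ?_, l, fun q hq => hl q (by simp [hq]), β, hβ, ?_⟩
        · simpa using (hl p (by simp)).2
        · rw [one_mul, ← mul_assoc, hbc]
          simp [mul_assoc]
    · exact Or.inr ⟨1, one_mem _, b * c, mul_mem hb hc, hbc, l, hl, β, hβ, by simp [mul_assoc]⟩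
  · refine Or.inr ⟨1, one_mem _, b, hb, hb1, (⟨α, hα⟩, ⟨c, hc⟩) :: l, ?_, β, hβ,
      by simp [mul_assoc]⟩
    intro p hp
    rcases List.mem_cons.1 hp with rfl | hp
    · simpa using ⟨hα1, hc1⟩
    · exact hl p hp

theorem mem_or_isAlternating {x : G} (hx : x ∈ A' ⊔ B') : x ∈ A' ∨ IsAlternating A' B' x := by
  rw [Subgroup.sup_eq_closure] at hx
  induction hx using Subgroup.closure_induction_left with
  | one => exact Or.inl (one_mem _)
  | mul_left x hx y _ ih =>
    rcases hx with hx | hx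
    · exact mem_or_isAlternating_mul_left hx ih
    · exact mem_or_isAlternating_mul_right_factor hx ih
  | inv_mul_cancel x hx y _ ih =>
    rcases hx with hx | hx
    · exact mem_or_isAlternating_mul_left (inv_mem hx) ih
    · exact mem_or_isAlternating_mul_right_factor (inv_mem hx) ih

/-- Subgroups of the factors that still generate must be the whole factors: an alternating
expression over `A'`, `B'` for an element of `A` would otherwise violate freeness. -/
theorem IsFreeSplitting.left_eq_of_sup_eq_top (h : IsFreeSplitting A B) (hA : A' ≤ A)
    (hB : B' ≤ B) (hsup : A' ⊔ B' = ⊤) : A' = A := by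
  refine le_antisymm hA fun a ha => ?_
  rcases mem_or_isAlternating (hsup ▸ Subgroup.mem_top a : a ∈ A' ⊔ B') with
    haA | ⟨α, hα, b, hb, hb1, l, hl, β, hβ, hx⟩
  · exact haA
  -- Cycling `a = α b l β` gives `(β a⁻¹ α) b l = 1`, with all other syllables nontrivial; so
  -- freeness forces the first to vanish, whence `a = α β` is in `A'`.
  by_cases h1 : β * a⁻¹ * α = 1
  · have : a = α * β := by
      have h2 : a⁻¹ = β⁻¹ * α⁻¹ := by
        rw [← mul_inv_rev, eq_inv_iff_mul_eq_one]
        calc a⁻¹ * (α * β) = β⁻¹ * (β * a⁻¹ * α) * β := by group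
          _ = 1 := by rw [h1]; group
      rw [← inv_inv a, h2]
      group
    exact this ▸ mul_mem hα hβ
  · exfalso
    have hmem : β * a⁻¹ * α ∈ A := mul_mem (mul_mem (hA hβ) (inv_mem ha)) (hA hα)
    obtain ⟨p, hp, hp1⟩ := h.free ((⟨_, hmem⟩, ⟨b, hB hb⟩) ::
        l.map (Prod.map (Subgroup.inclusion hA) (Subgroup.inclusion hB))) (by simp) (by
      have h2 : (l.map fun p => (p.1 : G) * (p.2 : G)).prod = b⁻¹ * α⁻¹ * a * β⁻¹ := by
        rw [hx]; group
      simp only [List.map_cons, List.map_map, List.prod_cons]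
      have h3 : ((fun p : A × B => (p.1 : G) * (p.2 : G)) ∘
          Prod.map (Subgroup.inclusion hA) (Subgroup.inclusion hB)) =
          fun p : A' × B' => (p.1 : G) * (p.2 : G) := rfl
      rw [h3, h2]
      group)
    rcases List.mem_cons.1 hp with rfl | hp
    · rcases hp1 with hp1 | hp1
      · exact h1 (congrArg Subtype.val hp1)
      · exact hb1 (congrArg Subtype.val hp1)
    · obtain ⟨q, hq, rfl⟩ := List.mem_map.1 hp
      rcases hp1 with hp1 | hp1
      · exact (hl q hq).1 (Subgroup.inclusion_injective hA hp1)
      · exact (hl q hq).2 (Subgroup.inclusion_injective hB hp1)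

/-- Rebracketing `a (b₁a₁)⋯(bₖaₖ) b` as `(a b₁)(a₁b₂)⋯(aₖ b)`. This lets freeness be transferred
when the factors are exchanged. -/
theorem exists_rotated_pairs (t : List (B × A)) (ht : ∀ p ∈ t, p.1 ≠ 1 ∧ p.2 ≠ 1) {a : A} {b : B}
    (ha : a ≠ 1) (hb : b ≠ 1) : ∃ l : List (A × B), l ≠ [] ∧ (∀ p ∈ l, p.1 ≠ 1 ∧ p.2 ≠ 1) ∧
      (l.map fun p => (p.1 : G) * (p.2 : G)).prod =
        a * (t.map fun p => (p.1 : G) * (p.2 : G)).prod * b := by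
  induction t generalizing a with
  | nil => exact ⟨[(a, b)], by simp, by simp [ha, hb], by simp⟩
  | cons p t ih =>
    have hp := ht p (by simp)
    obtain ⟨l, -, hl, hprod⟩ := ih (fun q hq => ht q (by simp [hq])) hp.2
    refine ⟨(a, p.1) :: l, by simp, ?_, by simp [hprod, mul_assoc]⟩
    intro q hq
    rcases List.mem_cons.1 hq with rfl | hq
    · exact ⟨ha, hp.1⟩
    · exact hl q hq

theorem IsFreeSplitting.symm (h : IsFreeSplitting A B) : IsFreeSplitting B A := by
  refine ⟨fun l hl hprod => ?_, by rw [sup_comm, h.generate]⟩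
  by_contra! hne
  cases l with
  | nil => exact hl rfl
  | cons p t =>
    have hp := hne p (by simp)
    obtain ⟨l', hl', hne', hprod'⟩ :=
      exists_rotated_pairs t (fun q hq => hne q (by simp [hq])) hp.2 hp.1
    obtain ⟨q, hq, hq1⟩ := h.free l' hl' (by
      -- The rotated product is a conjugate of the original relation by its first syllable.
      rw [hprod']
      simp only [List.map_cons, List.prod_cons] at hprod
      calc _ = (p.1 : G)⁻¹ * (p.1 * p.2 * (t.map fun p => (p.1 : G) * (p.2 : G)).prod) * p.1 := by
            group
        _ = 1 := by rw [hprod]; group)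
    rcases hq1 with hq1 | hq1
    · exact (hne' q hq).1 hq1
    · exact (hne' q hq).2 hq1

theorem exists_fg_of_mem_sup {x : G} (hx : x ∈ A ⊔ B) :
    ∃ A' ≤ A, ∃ B' ≤ B, A'.FG ∧ B'.FG ∧ x ∈ A' ⊔ B' := by
  rw [Subgroup.sup_eq_closure] at hx
  induction hx using Subgroup.closure_induction with
  | mem x hx =>
    rcases hx with hx | hx
    · exact ⟨Subgroup.zpowers x, by simpa using hx, ⊥, bot_le,
        ⟨{x}, by simp [Subgroup.zpowers_eq_closure]⟩, ⟨∅, by simp⟩, by simp⟩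
    · exact ⟨⊥, bot_le, Subgroup.zpowers x, by simpa using hx, ⟨∅, by simp⟩,
        ⟨{x}, by simp [Subgroup.zpowers_eq_closure]⟩, by simp⟩
  | one => exact ⟨⊥, bot_le, ⊥, bot_le, ⟨∅, by simp⟩, ⟨∅, by simp⟩, one_mem _⟩
  | mul x y _ _ hx hy =>
    obtain ⟨A₁, hA₁, B₁, hB₁, fA₁, fB₁, h₁⟩ := hx
    obtain ⟨A₂, hA₂, B₂, hB₂, fA₂, fB₂, h₂⟩ := hy
    exact ⟨A₁ ⊔ A₂, sup_le hA₁ hA₂, B₁ ⊔ B₂, sup_le hB₁ hB₂, fA₁.sup fA₂, fB₁.sup fB₂,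
      mul_mem ((sup_le_sup le_sup_left le_sup_left : A₁ ⊔ B₁ ≤ _) h₁)
        ((sup_le_sup le_sup_right le_sup_right : A₂ ⊔ B₂ ≤ _) h₂)⟩
  | inv x _ hx =>
    obtain ⟨A₁, hA₁, B₁, hB₁, fA₁, fB₁, h₁⟩ := hx
    exact ⟨A₁, hA₁, B₁, hB₁, fA₁, fB₁, inv_mem h₁⟩

theorem closure_range_basis_eq_top {ι : Type*} (b : FreeGroupBasis ι G) :
    Subgroup.closure (Set.range b) = ⊤ := by
  have h := congrArg (Subgroup.map b.repr.symm.toMonoidHom) (FreeGroup.closure_range_of ι)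
  rw [MonoidHom.map_closure, Subgroup.map_top_of_surjective _ b.repr.symm.surjective,
    ← Set.range_comp] at h
  exact h

/-- Writing the finitely many basis elements needs only finitely generated parts of `A` and `B`;
these already generate the group, so they are all of `A` and `B`. -/
theorem IsFreeSplitting.fg {ι : Type*} [Finite ι] (b : FreeGroupBasis ι G)
    (h : IsFreeSplitting A B) : A.FG ∧ B.FG := by
  choose A₁ hA₁ B₁ hB₁ fA₁ fB₁ hmem using fun i : ι =>
    exists_fg_of_mem_sup (h.generate ▸ Subgroup.mem_top (b i) : b i ∈ A ⊔ B)
  have hA : ⨆ i, A₁ i ≤ A := iSup_le hA₁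
  have hB : ⨆ i, B₁ i ≤ B := iSup_le hB₁
  have htop : (⨆ i, A₁ i) ⊔ ⨆ i, B₁ i = ⊤ := by
    rw [eq_top_iff, ← closure_range_basis_eq_top b, Subgroup.closure_le]
    rintro _ ⟨i, rfl⟩
    exact (sup_le_sup (le_iSup A₁ i) (le_iSup B₁ i) : A₁ i ⊔ B₁ i ≤ _) (hmem i)
  rw [← h.left_eq_of_sup_eq_top hA hB htop,
    ← h.symm.left_eq_of_sup_eq_top hB hA (by rw [sup_comm, htop])]
  exact ⟨Subgroup.FG.iSup _ fA₁, Subgroup.FG.iSup _ fB₁⟩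

end FiniteGeneration

/-! ### Transfer to an arbitrary free basis, and the decision predicate. -/

section Presentations

variable {n : ℕ} {F : Type*} [Group F] (b : FreeGroupBasis (Fin n) F)

theorem repr_evalWord (w : Word n) : b.repr (evalWord b w) = FreeGroup.mk w := by
  simp [evalWord]

theorem evalWord_toWord_repr (g : F) : evalWord b (b.repr g).toWord = g := by
  simp [evalWord, FreeGroup.mk_toWord]

theorem exists_words_of_fg {A : Subgroup F} (hA : A.FG) :
    ∃ W : List (Word n), Subgroup.closure {g | ∃ w ∈ W, evalWord b w = g} = A := by
  obtain ⟨S, rfl⟩ := hA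
  refine ⟨S.toList.map fun g => (b.repr g).toWord, ?_⟩
  congr 1
  ext g
  simp [evalWord_toWord_repr]

theorem mem_closure_evalWord_iff {W : List (Word n)} {g : F} :
    g ∈ Subgroup.closure {g | ∃ w ∈ W, evalWord b w = g} ↔ b.repr g ∈ wordsSubgroup W := by
  have h : wordsSubgroup W = (Subgroup.closure {g | ∃ w ∈ W, evalWord b w = g}).map
      b.repr.toMonoidHom := by
    rw [MonoidHom.map_closure, wordsSubgroup]
    congr 1
    ext x
    simp only [Set.mem_ofPred_eq, Set.mem_image, MulEquiv.coe_toMonoidHom]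
    constructor
    · rintro ⟨w, hw, rfl⟩
      exact ⟨_, ⟨w, hw, rfl⟩, repr_evalWord b w⟩
    · rintro ⟨_, ⟨w, hw, rfl⟩, rfl⟩
      exact ⟨w, hw, (repr_evalWord b w).symm⟩
  rw [h]
  exact (Subgroup.mem_map_iff_mem (f := b.repr.toMonoidHom) b.repr.injective).symm

/-- The decision predicate for the existence of a common nontrivial elliptic element. -/
def CommonElliptic (p q : SplittingCode n) : Prop :=
  (ConjMeet p.1 q.1 ∨ ConjMeet p.1 q.2) ∨ (ConjMeet p.2 q.1 ∨ ConjMeet p.2 q.2)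

theorem primrecPred_commonElliptic :
    PrimrecPred fun x : SplittingCode n × SplittingCode n => CommonElliptic x.1 x.2 := by
  have h1 := Primrec.fst (α := SplittingCode n) (β := SplittingCode n)
  have h2 := Primrec.snd (α := SplittingCode n) (β := SplittingCode n)
  exact ((primrecRel_conjMeet.comp (Primrec.fst.comp h1) (Primrec.fst.comp h2)).or
      (primrecRel_conjMeet.comp (Primrec.fst.comp h1) (Primrec.snd.comp h2))).or
    ((primrecRel_conjMeet.comp (Primrec.snd.comp h1) (Primrec.fst.comp h2)).or
      (primrecRel_conjMeet.comp (Primrec.snd.comp h1) (Primrec.snd.comp h2)))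

theorem mem_conjSubgroup_iff {x g : F} {A : Subgroup F} :
    g ∈ conjSubgroup x A ↔ x⁻¹ * g * x ∈ A := by
  simp only [conjSubgroup, Subgroup.mem_map, MulEquiv.coe_toMonoidHom, MulAut.conj_apply]
  constructor
  · rintro ⟨y, hy, rfl⟩
    simpa [mul_assoc] using hy
  · exact fun h => ⟨_, h, by group⟩

theorem conjMeet_iff_exists_conjSubgroup {W K : List (Word n)} {A C : Subgroup F}
    (hA : Subgroup.closure {g | ∃ w ∈ W, evalWord b w = g} = A)
    (hC : Subgroup.closure {g | ∃ w ∈ K, evalWord b w = g} = C) :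
    ConjMeet W K ↔ ∃ g : F, g ≠ 1 ∧ (∃ x, g ∈ conjSubgroup x A) ∧ ∃ y, g ∈ conjSubgroup y C := by
  subst hA hC
  rw [conjMeet_iff]
  simp only [mem_conjSubgroup_iff, mem_closure_evalWord_iff]
  constructor
  · rintro ⟨g, hg, ⟨x, hx⟩, y, hy⟩
    refine ⟨b.repr.symm g, by simpa using hg, ⟨b.repr.symm x⁻¹, by simpa using hx⟩,
      b.repr.symm y⁻¹, by simpa using hy⟩
  · rintro ⟨g, hg, ⟨x, hx⟩, y, hy⟩
    refine ⟨b.repr g, by simpa using hg, ⟨b.repr x⁻¹, by simpa using hx⟩,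
      b.repr y⁻¹, by simpa using hy⟩

theorem commonElliptic_iff {p q : SplittingCode n} {A B C D : Subgroup F}
    (hp : Presents b p A B) (hq : Presents b q C D) : CommonElliptic p q ↔
      ∃ g : F, g ≠ 1 ∧ IsElliptic A B g ∧ IsElliptic C D g := by
  rw [CommonElliptic, conjMeet_iff_exists_conjSubgroup b hp.1 hq.1,
    conjMeet_iff_exists_conjSubgroup b hp.1 hq.2, conjMeet_iff_exists_conjSubgroup b hp.2 hq.1,
    conjMeet_iff_exists_conjSubgroup b hp.2 hq.2]
  simp only [IsElliptic, ← exists_or, ← and_or_left, ← or_and_right]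

end Presentations

/-! ### Invariance of ellipticity under conjugation and equivalence. -/

section Elliptic

variable {G : Type*} [Group G] {A B : Subgroup G}

theorem IsElliptic.conj {g : G} (h : IsElliptic A B g) (y : G) :
    IsElliptic A B (y * g * y⁻¹) := by
  obtain ⟨x, h⟩ := h
  simp only [mem_conjSubgroup_iff] at h
  refine ⟨y * x, ?_⟩
  simp only [mem_conjSubgroup_iff]
  have : (y * x)⁻¹ * (y * g * y⁻¹) * (y * x) = x⁻¹ * g * x := by group
  rwa [this]

theorem isElliptic_conjSubgroup {x g : G} :
    IsElliptic (conjSubgroup x A) (conjSubgroup x B) g ↔ IsElliptic A B g := by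
  simp only [IsElliptic, ← conjSubgroup_mul]
  constructor
  · rintro ⟨y, h⟩
    exact ⟨y * x, h⟩
  · rintro ⟨y, h⟩
    exact ⟨y * x⁻¹, by simpa using h⟩

theorem isElliptic_swap {g : G} : IsElliptic A B g ↔ IsElliptic B A g := by
  simp only [IsElliptic, or_comm]

theorem isElliptic_congr {S T : ProperFreeSplitting G}
    (h : (Quotient.mk _ S : SplittingClass G) = Quotient.mk _ T) {g : G} :
    IsElliptic S.left S.right g ↔ IsElliptic T.left T.right g := by
  obtain ⟨x, ⟨h1, h2⟩ | ⟨h1, h2⟩⟩ := Quotient.exact h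
  · rw [h1, h2, isElliptic_conjSubgroup]
  · rw [h1, h2, isElliptic_conjSubgroup, isElliptic_swap]

/-- Were the left factor trivial, the right one would be everything. This settles the case of two
equal classes, at distance zero. -/
theorem ProperFreeSplitting.exists_isElliptic (S : ProperFreeSplitting G) :
    ∃ g : G, g ≠ 1 ∧ IsElliptic S.left S.right g := by
  have hne : S.left ≠ ⊥ := by
    intro h
    have := S.isFreeSplitting.generate
    rw [h, bot_sup_eq] at this
    exact S.right_ne_top this
  obtain ⟨a, ha⟩ := (Subgroup.ne_bot_iff_exists_ne_one).1 hne
  exact ⟨a, fun h => ha (Subtype.ext h), 1, Or.inl (by rw [conjSubgroup_one]; exact a.2)⟩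

end Elliptic

/-! ### Cyclic words and nontrivial conjugacy classes. -/

section CyclicWords

variable {n : ℕ} {F : Type*} [Group F] (b : FreeGroupBasis (Fin n) F)

theorem evalWord_append (u v : Word n) : evalWord b (u ++ v) = evalWord b u * evalWord b v := by
  simp [evalWord, ← FreeGroup.mul_mk]

theorem exists_conj_evalWord {l l' : Word n} (h : l ~r l') :
    ∃ y, evalWord b l' = y * evalWord b l * y⁻¹ := by
  obtain ⟨k, rfl⟩ := h
  refine ⟨(evalWord b (l.take (k % l.length)))⁻¹, ?_⟩
  conv_rhs => rw [← List.take_append_drop (k % l.length) l]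
  rw [List.rotate_eq_drop_append_take_mod, evalWord_append, evalWord_append]
  simp

/-- Different linear readings are conjugate, and ellipticity depends only on the conjugacy class and
on the class of the splitting. -/
theorem CyclicWord.isElliptic_of_isEllipticTo {w : CyclicWord n} {S : ProperFreeSplitting F}
    (h : w.IsEllipticTo b (Quotient.mk _ S)) {l : Word n}
    (hl : (l : Cycle (Fin n × Bool)) = w.1) : IsElliptic S.left S.right (evalWord b l) := by
  obtain ⟨T, l', hT, hl', he⟩ := h
  obtain ⟨y, hy⟩ := exists_conj_evalWord b (Cycle.coe_eq_coe.1 (hl'.trans hl.symm))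
  rw [← isElliptic_congr hT, hy]
  exact he.conj y

theorem CyclicWord.evalWord_ne_one {w : CyclicWord n} {l : Word n}
    (hl : (l : Cycle (Fin n × Bool)) = w.1) : evalWord b l ≠ 1 := by
  obtain ⟨c, hnil, hc⟩ := w
  subst hl
  cases l with
  | nil => exact absurd rfl hnil
  | cons a t =>
    rw [Cycle.chain_coe_cons] at hc
    have hred : FreeGroup.IsReduced (a :: t) :=
      (hc.prefix ⟨[a], by simp⟩).imp fun x y hxy h1 => by
        rcases x with ⟨i, _ | _⟩ <;> rcases y with ⟨j, _ | _⟩ <;> simp_all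
    intro h
    have h1 : FreeGroup.mk (a :: t) = 1 := b.repr.symm.map_eq_one_iff.1 h
    have h2 := congrArg FreeGroup.toWord h1
    rw [FreeGroup.toWord_mk, hred.reduce_eq, FreeGroup.toWord_one] at h2
    exact List.cons_ne_nil _ _ h2

/-- Cyclic reduction of the reduced word of `g` conjugates it; the result is nonempty because `g` is
nontrivial. -/
theorem exists_cyclicWord_conj {g : F} (hg : g ≠ 1) :
    ∃ (w : CyclicWord n) (l : Word n), (l : Cycle (Fin n × Bool)) = w.1 ∧
      ∃ y, evalWord b l = y * g * y⁻¹ := by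
  set L := (b.repr g).toWord with hL
  have hconj := FreeGroup.reduceCyclically.conj_conjugator_reduceCyclically L
  have hred := FreeGroup.reduceCyclically.isCyclicallyReduced
    (FreeGroup.isReduced_toWord (x := b.repr g))
  rw [← hL] at hred
  generalize FreeGroup.reduceCyclically L = l at hconj hred
  have hy : evalWord b l = (evalWord b (FreeGroup.reduceCyclically.conjugator L))⁻¹ * g *
      ((evalWord b (FreeGroup.reduceCyclically.conjugator L))⁻¹)⁻¹ := by
    have h1 : evalWord b L = g := evalWord_toWord_repr b g
    rw [← hconj, evalWord_append, evalWord_append] at h1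
    have h2 : evalWord b (FreeGroup.invRev (FreeGroup.reduceCyclically.conjugator L)) =
        (evalWord b (FreeGroup.reduceCyclically.conjugator L))⁻¹ := by
      simp [evalWord, ← FreeGroup.inv_mk]
    rw [h2] at h1
    rw [← h1]
    group
  cases l with
  | nil =>
    exfalso
    apply hg
    have h3 : evalWord b ([] : Word n) = 1 := by simp [evalWord, ← FreeGroup.one_eq_mk]
    rw [h3, eq_comm, conj_eq_one_iff] at hy
    exact hy
  | cons a t =>
    refine ⟨⟨((a :: t : Word n) : Cycle (Fin n × Bool)), by simp, ?_⟩, a :: t, rfl, _, hy⟩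
    -- The cyclic condition splits into reducedness of the linear word and the condition at the
    -- junction of last and first letters.
    rw [Cycle.chain_coe_cons, ← List.cons_append, List.isChain_append]
    refine ⟨hred.isReduced.imp ?_, List.isChain_singleton _, ?_⟩
    · rintro x y hxy ⟨h1, h2⟩
      rw [hxy h1] at h2
      simp at h2
    · rintro x hx y hy ⟨h1, h2⟩
      have := hred.2 x hx y (by simpa using hy) h1
      rw [this] at h2
      simp at h2

end CyclicWords

/-! ### Distances in the ellipticity graph. -/

section Graph

variable {n : ℕ} {F : Type*} [Group F] (b : FreeGroupBasis (Fin n) F)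

theorem ellipticityGraph_adj_inl_inr {c : SplittingClass F} {w : CyclicWord n} :
    (ellipticityGraph b).Adj (Sum.inl c) (Sum.inr w) ↔ w.IsEllipticTo b c := by
  simp [ellipticityGraph]

theorem not_ellipticityGraph_adj_inl_inl {c d : SplittingClass F} :
    ¬ (ellipticityGraph b).Adj (Sum.inl c) (Sum.inl d) := by
  simp [ellipticityGraph]

/-- By bipartiteness distinct classes are never adjacent, and a common neighbour is a cyclic word,
that is, a nontrivial conjugacy class elliptic to both. -/
theorem edist_eq_two_iff_exists_isElliptic {S T : ProperFreeSplitting F}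
    (hST : (Quotient.mk _ S : SplittingClass F) ≠ Quotient.mk _ T) :
    (ellipticityGraph b).edist (Sum.inl (Quotient.mk _ S)) (Sum.inl (Quotient.mk _ T)) = 2 ↔
      ∃ g : F, g ≠ 1 ∧ IsElliptic S.left S.right g ∧ IsElliptic T.left T.right g := by
  rw [SimpleGraph.edist_eq_two_iff]
  constructor
  · rintro ⟨-, -, c | w, h⟩
    · exact absurd h.1 (not_ellipticityGraph_adj_inl_inl b)
    · obtain ⟨l, hl⟩ := Quotient.exists_rep w.1
      exact ⟨evalWord b l, CyclicWord.evalWord_ne_one b hl,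
        CyclicWord.isElliptic_of_isEllipticTo b ((ellipticityGraph_adj_inl_inr b).1 h.1) hl,
        CyclicWord.isElliptic_of_isEllipticTo b ((ellipticityGraph_adj_inl_inr b).1 h.2) hl⟩
  · rintro ⟨g, hg, hS, hT⟩
    obtain ⟨w, l, hl, y, hy⟩ := exists_cyclicWord_conj b hg
    refine ⟨fun h => hST (Sum.inl_injective h), not_ellipticityGraph_adj_inl_inl b, Sum.inr w,
      (ellipticityGraph_adj_inl_inr b).2 ⟨S, l, rfl, hl, hy ▸ hS.conj y⟩,
      (ellipticityGraph_adj_inl_inr b).2 ⟨T, l, rfl, hl, hy ▸ hT.conj y⟩⟩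

theorem edist_le_two_iff_eq_two {S T : ProperFreeSplitting F}
    (hST : (Quotient.mk _ S : SplittingClass F) ≠ Quotient.mk _ T) :
    (ellipticityGraph b).edist (Sum.inl (Quotient.mk _ S)) (Sum.inl (Quotient.mk _ T)) ≤ 2 ↔
      (ellipticityGraph b).edist (Sum.inl (Quotient.mk _ S)) (Sum.inl (Quotient.mk _ T)) = 2 := by
  refine ⟨fun h => le_antisymm h ?_, le_of_eq⟩
  have h1 : ¬ (ellipticityGraph b).edist (Sum.inl (Quotient.mk _ S))
      (Sum.inl (Quotient.mk _ T)) ≤ 1 := by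
    rw [SimpleGraph.edist_le_one_iff_adj_or_eq]
    rintro (h | h)
    · exact not_ellipticityGraph_adj_inl_inl b h
    · exact hST (Sum.inl_injective h)
  have h2 := Order.add_one_le_of_lt (not_le.1 h1)
  rwa [one_add_one_eq_two] at h2

theorem edist_le_two_iff_exists_isElliptic (S T : ProperFreeSplitting F) :
    (ellipticityGraph b).edist (Sum.inl (Quotient.mk _ S)) (Sum.inl (Quotient.mk _ T)) ≤ 2 ↔
      ∃ g : F, g ≠ 1 ∧ IsElliptic S.left S.right g ∧ IsElliptic T.left T.right g := by
  by_cases hST : (Quotient.mk _ S : SplittingClass F) = Quotient.mk _ T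
  · obtain ⟨g, hg, hS⟩ := S.exists_isElliptic
    rw [hST, SimpleGraph.edist_self]
    exact ⟨fun _ => ⟨g, hg, hS, (isElliptic_congr hST).1 hS⟩, fun _ => zero_le⟩
  · rw [edist_le_two_iff_eq_two b hST, edist_eq_two_iff_exists_isElliptic b hST]

end Graph

end EllipticityGraph

theorem mainTheorem1 {n : ℕ} {F : Type*} [Group F] (b : FreeGroupBasis (Fin n) F) :
    (∀ A B : Subgroup F, EllipticityGraph.IsFreeSplitting A B →
      ∃ p : EllipticityGraph.SplittingCode n, EllipticityGraph.Presents b p A B) ∧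
    ∃ f : EllipticityGraph.SplittingCode n × EllipticityGraph.SplittingCode n → Bool,
      Computable f ∧
      (∀ (p q : EllipticityGraph.SplittingCode n) (A B C D : Subgroup F),
        EllipticityGraph.IsFreeSplitting A B → EllipticityGraph.IsFreeSplitting C D →
        EllipticityGraph.Presents b p A B → EllipticityGraph.Presents b q C D →
        (f (p, q) = true ↔
          ∃ g : F, g ≠ 1 ∧ EllipticityGraph.IsElliptic A B g ∧
            EllipticityGraph.IsElliptic C D g)) ∧
      (∀ (p q : EllipticityGraph.SplittingCode n)
        (S T : EllipticityGraph.ProperFreeSplitting F),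
        EllipticityGraph.Presents b p S.left S.right →
        EllipticityGraph.Presents b q T.left T.right →
        (f (p, q) = true ↔
          (EllipticityGraph.ellipticityGraph b).edist
            (Sum.inl (Quotient.mk _ S)) (Sum.inl (Quotient.mk _ T)) ≤ 2) ∧
        ((Quotient.mk _ S : EllipticityGraph.SplittingClass F) ≠ Quotient.mk _ T →
          (f (p, q) = true ↔
            (EllipticityGraph.ellipticityGraph b).edist
              (Sum.inl (Quotient.mk _ S)) (Sum.inl (Quotient.mk _ T)) = 2))) := by
  classical
  refine ⟨fun A B h => ?_,
    fun x => decide (EllipticityGraph.CommonElliptic x.1 x.2),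
    EllipticityGraph.primrecPred_commonElliptic.decide.to_comp, ?_, ?_⟩
  · obtain ⟨hA, hB⟩ := h.fg b
    obtain ⟨W, hW⟩ := EllipticityGraph.exists_words_of_fg b hA
    obtain ⟨K, hK⟩ := EllipticityGraph.exists_words_of_fg b hB
    exact ⟨(W, K), hW, hK⟩
  · intro p q A B C D _ _ hp hq
    rw [decide_eq_true_iff]
    exact EllipticityGraph.commonElliptic_iff b hp hq
  · intro p q S T hp hq
    rw [decide_eq_true_iff, EllipticityGraph.commonElliptic_iff b hp hq]
    exact ⟨(EllipticityGraph.edist_le_two_iff_exists_isElliptic b S T).symm,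
      fun hST => (EllipticityGraph.edist_eq_two_iff_exists_isElliptic b hST).symm⟩
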